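/- Fix an integer $m\ge 1$, $\mu\in\mathbb R$, $A<0$ and $\vec a\in\mathbb R^{2m}$ with $a_1>a_2>\cdots>a_{2m}$. Let $g:[A,0]\to\mathbb R\cup\{-\infty\}$ be continuous with $g(A)<a_{2m}$. For $L\ge 1$ let $\vec a_L\in\mathbb R^{2m}$ and let $g_L:[A,0]\to\mathbb R\cup\{-\infty\}$ be continuous, such that $\vec a_L\to\vec a$ and $g_L\to g$ uniformly on $[A,0]$ as $L\to\infty$. (Continuity is with respect to the usual topology of $[-\infty,\infty)$, and uniform convergence is with respect to the distance $|e^u-e^v|$ on $[-\infty,\infty)$, where $e^{-\infty}=0$; this is ordinary uniform convergence when $g$ is real-valued.) Given $\alpha\in\mathbb R$ and $L\ge 1$, the scale-$L$ one-sided HSKPZ Gibbs measure $\mathbf P_{L;g_L}^{2m;A;\vec a_L,\star}$ is the probability measure on $C([A,0],\mathbb R^{2m})$ given by $$\mathbf P_{L;g_L}^{2m;A;\vec a_L,\star}(\mathsf A)=\frac{\mathbf E_\alpha[\mathcal W_{L;g_L}(B)\mathbf 1_{\mathsf A}]}{\mathbf E_\alpha[\mathcal W_{L;g_L}(B)]},\qquad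 \mathcal W_{L;g_L}(B)=\prod_{i=1}^{2m}\exp\Big(-L\int_A^0 e^{\sqrt L\,(B_{i+1}(x)-B_i(x))}\,dx\Big),\quad B_{2m+1}:=g_L,$$ where under $\mathbf E_\alpha$ the processes $B_1,\dots,B_{2m}$ are independent Brownian motions on $[A,0]$ with $B(A)=\vec a_L$ and with drifts $(-1)^i\alpha\sqrt L$. Take $\alpha=\mu/\sqrt L$. Then, as $L\to\infty$, the measures $\mathbf P_{L;g_L}^{2m;A;\vec a_L,\star}$ converge weakly, as probability measures on $C([A,0],\mathbb R^{2m})$ with the uniform topology, to the law of independent Brownian motions $B_1,\dots,B_{2m}$ on $[A,0]$ with $B(A)=\vec a$ and drifts $(-1)^i\mu$, conditioned on the event (which has positive probability) that $$B_1(x)>B_2(x)>\cdots>B_{2m}(x)>g(x)\quad\text{for all }x\in[A,0].$$ -/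

import Mathlib

open MeasureTheory ProbabilityTheory Filter Topology
open scoped NNReal ENNReal

noncomputable section

/-- Continuous `n`-tuples of curves on `[A, 0]`. The interval is compact, so the topology of this
space is that of uniform convergence. -/
abbrev PathSpace (A : ℝ) (n : ℕ) : Type := C(Set.Icc A 0, Fin n → ℝ)

instance PathSpace.instMeasurableSpace (A : ℝ) (n : ℕ) : MeasurableSpace (PathSpace A n) :=
  borel _

instance PathSpace.instBorelSpace (A : ℝ) (n : ℕ) : BorelSpace (PathSpace A n) := ⟨rfl⟩

/-- The trajectories `x ↦ a i + v i * (x - A) + W i (x - A)` on `[A, 0]`. If the `W i` are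
independent standard Brownian motions, these are independent Brownian motions on `[A, 0]` with
drifts `v i` which start from `a i` at `x = A`. -/
def driftedTrajectory {Ω : Type*} {n : ℕ} (W : Fin n → ℝ≥0 → Ω → ℝ) (A : ℝ) (a v : Fin n → ℝ)
    (ω : Ω) (x : Set.Icc A 0) (i : Fin n) : ℝ :=
  a i + v i * ((x : ℝ) - A) + W i (Real.toNNReal ((x : ℝ) - A)) ω

open Classical in
/-- The trajectories above as an element of path space. For Brownian motions the trajectories are
almost surely continuous; the value on the exceptional null set is irrelevant for the law. -/
def driftedPath {Ω : Type*} {n : ℕ} (W : Fin n → ℝ≥0 → Ω → ℝ) (A : ℝ) (a v : Fin n → ℝ)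
    (ω : Ω) : PathSpace A n :=
  if h : Continuous (driftedTrajectory W A a v ω) then ⟨driftedTrajectory W A a v ω, h⟩ else 0

/-- The law on path space of independent Brownian motions on `[A, 0]`, started from `a`, with
drift vector `v`. -/
def driftedBrownianLaw {Ω : Type*} [MeasurableSpace Ω] (P : Measure Ω) {n : ℕ}
    (W : Fin n → ℝ≥0 → Ω → ℝ) (A : ℝ) (a v : Fin n → ℝ) : Measure (PathSpace A n) :=
  P.map (driftedPath W A a v)

/-- The curves `B_0, B_1, …, B_n, B_{n+1}` with `B_0 = +∞` (no ceiling), `B_1, …, B_n` the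
coordinates of `B`, and `B_{n+1} = g` (the floor). -/
def curve {A : ℝ} {n : ℕ} (B : PathSpace A n) (g : Set.Icc A 0 → EReal) :
    ℕ → Set.Icc A 0 → EReal
  | 0, _ => ⊤
  | i + 1, x => if h : i < n then ((B x ⟨i, h⟩ : ℝ) : EReal) else g x

/-- The continuous Radon–Nikodym weight with no ceiling and floor `g`,
`∏_{i=0}^{n} exp (-L ∫_A^0 exp (√L (B_{i+1}(x) - B_i(x))) dx)`, where `exp (-∞) = 0`. -/
def gibbsWeight {A : ℝ} {n : ℕ} (L : ℝ) (g : Set.Icc A 0 → EReal) (B : PathSpace A n) : ℝ :=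
  ∏ i ∈ Finset.range (n + 1),
    Real.exp (-L * ∫ x : Set.Icc A 0,
      (EReal.exp ((√L : EReal) * (curve B g (i + 1) x - curve B g i x))).toReal
        ∂(volume.comap Subtype.val))

/-- The drift vector whose `i`-th entry, counted from `i = 1`, is `(-1)^i c`. -/
def alternatingDrift (n : ℕ) (c : ℝ) : Fin n → ℝ := fun j ↦ (-1) ^ ((j : ℕ) + 1) * c

/-- The scale-`L` one-sided HSKPZ Gibbs measure with parameter `α`, starting points `a` at `A`,
no ceiling and floor `g`: the law of independent Brownian motions with drifts `(-1)^i α √L`,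
reweighted by `gibbsWeight L g` and normalized. -/
def oneSidedGibbs {Ω : Type*} [MeasurableSpace Ω] (P : Measure Ω) {n : ℕ}
    (W : Fin n → ℝ≥0 → Ω → ℝ) (α L A : ℝ) (a : Fin n → ℝ) (g : Set.Icc A 0 → EReal) :
    Measure (PathSpace A n) :=
  let ν := driftedBrownianLaw P W A a (alternatingDrift n (α * √L))
  (∫⁻ B, ENNReal.ofReal (gibbsWeight L g B) ∂ν)⁻¹ •
    ν.withDensity fun B ↦ ENNReal.ofReal (gibbsWeight L g B)

/-- The event `B_1(x) > B_2(x) > ⋯ > B_n(x) > g(x)` for all `x ∈ [A, 0]`. -/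
def nonIntersecting {A : ℝ} {n : ℕ} (g : Set.Icc A 0 → EReal) : Set (PathSpace A n) :=
  {B | ∀ x, ∀ i ∈ Finset.Icc 1 n, curve B g (i + 1) x < curve B g i x}

/-- Independent Brownian motions started from `a` at `A`, with drifts `(-1)^i μ`, conditioned on
`B_1 > ⋯ > B_n > g` on all of `[A, 0]`. -/
def nonIntersectingLaw {Ω : Type*} [MeasurableSpace Ω] (P : Measure Ω) {n : ℕ}
    (W : Fin n → ℝ≥0 → Ω → ℝ) (μ A : ℝ) (a : Fin n → ℝ) (g : Set.Icc A 0 → EReal) :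
    Measure (PathSpace A n) :=
  ProbabilityTheory.cond (driftedBrownianLaw P W A a (alternatingDrift n μ)) (nonIntersecting g)

/-- Uniform convergence of functions with values in `ℝ ∪ {-∞} = [-∞, ∞)`, with respect to the
distance `|exp u - exp v|`, which metrizes `[-∞, ∞)`. If the limit is a continuous real-valued
function on `[A, 0]` this is ordinary uniform convergence; if the limit is identically `-∞` it
says that the suprema tend to `-∞`. -/
def FloorsTendstoUniformly {ι : Type*} {A : ℝ} (gL : ι → Set.Icc A 0 → EReal)
    (g : Set.Icc A 0 → EReal) (l : Filter ι) : Prop :=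
  TendstoUniformly (fun L x ↦ (EReal.exp (gL L x)).toReal) (fun x ↦ (EReal.exp (g x)).toReal) l

end

/-! Since `α√L = μ`, the drifts do not depend on the scale, so all scales are driven by the same
Brownian motions and only the starting points, the floor and the weight vary. Put `u = exp (B_{i+1}
- B_i)`; each factor of the weight is then `exp (-L ∫ u^√L)`. If `u < 1` everywhere, compactness
bounds `u` by some `r < 1` and `L r^√L → 0`, so the factor tends to 1. If `u > 1` somewhere, it is
so on a set of positive length, and the factor tends to 0. Both limits survive a uniform
perturbation of `u` (`tendsto_gibbsWeight_of_mem`, `tendsto_gibbsWeight_of_curve_lt`).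

Only paths that touch without crossing remain, and they form a null event
(`ae_driftedPath_mem_nonIntersecting_or`): given the bridge part of a Brownian motion, touching a
floor from above prescribes the endpoint exactly, whereas the endpoint is independent of the bridge
and has no atoms. Hence the weight converges almost surely to the indicator of non-intersection, and
dominated convergence handles numerator and normalizer (`tendsto_integral_gibbsWeight_mul`).

The quotient converges because non-intersection has positive probability
(`measure_driftedPath_mem_nonIntersecting_ne_zero`): with positive probability the curves follow
parallel lines, steep enough to stay above the floor. This rests on a small-ball bound for centered
Gaussian processes. -/

/-! ### Gaussian estimates: no touching without crossing, and small tubes. -/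

section Gaussian

variable {Ω : Type*} [MeasurableSpace Ω] {P : Measure Ω}

/-- The bridge `X t - (t / T) X T` of a Brownian motion is independent of the endpoint `X T`. -/
lemma ProbabilityTheory.IsPreBrownianReal.indepFun_bridge {X : ℝ≥0 → Ω → ℝ}
    (hX : IsPreBrownianReal X P) {T : ℝ≥0} (hT : T ≠ 0) :
    IndepFun (fun ω (t : Set.Iic T) ↦ X t ω - t / T * X T ω) (X T) P := by
  classical
  have := hX.isGaussianProcess.isProbabilityMeasure
  have mX t := hX.aemeasurable t
  -- Bridge and endpoint are jointly Gaussian, being linear in `X`, and uncorrelated because `t - (t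
  -- / T) T = 0`. The endpoint is treated as a process indexed by `Unit` to fit the criterion for
  -- processes.
  have key : IndepFun (fun ω (t : Set.Iic T) ↦ X t ω - t / T * X T ω)
      (fun ω (_ : Unit) ↦ X T ω) P := by
    apply IsGaussianProcess.indepFun_of_covariance_eq_zero
    · apply hX.isGaussianProcess.of_isGaussianProcess
      rintro (⟨t, ht⟩ | _)
      · exact ⟨{t, T},
          { toFun x := x ⟨t, by simp⟩ - t / T * x ⟨T, by simp⟩
            map_add' x y := by simp; ring
            map_smul' c x := by simp; ring }, by simp⟩
      · exact ⟨{T},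
          { toFun x := x ⟨T, by simp⟩
            map_add' x y := by simp
            map_smul' c x := by simp }, by simp⟩
    any_goals fun_prop
    · rintro ⟨t, ht : t ≤ T⟩ _
      rw [covariance_fun_sub_left, covariance_const_mul_left, hX.covariance_eval,
        hX.covariance_eval, min_eq_left ht, min_self]
      · have : (T : ℝ) ≠ 0 := by exact_mod_cast hT
        field_simp
        simp
      · exact (hX.isGaussianProcess.hasGaussianLaw_eval _).memLp_two
      · exact ((hX.isGaussianProcess.hasGaussianLaw_eval _).memLp_two).const_mul _
      · exact (hX.isGaussianProcess.hasGaussianLaw_eval _).memLp_two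
  exact key.comp measurable_id (measurable_pi_apply ())

/-- A random variable without atoms almost surely differs from any random variable independent
of it. -/
lemma ProbabilityTheory.IndepFun.ae_ne {β γ : Type*} [MeasurableSpace β] [MeasurableSpace γ]
    [MeasurableEq γ] [IsFiniteMeasure P] {S : Ω → γ} {N : Ω → β} (h : IndepFun S N P)
    (hS : AEMeasurable S P) (hN : AEMeasurable N P) {e : β → γ} (he : Measurable e)
    (hinj : Function.Injective e) [NullSingletonClass (P.map N)] :
    ∀ᵐ ω ∂P, S ω ≠ e (N ω) := by
  have hprod := (indepFun_iff_map_prod_eq_prod_map_map hS hN).1 h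
  have hm : MeasurableSet {p : γ × β | p.1 = e p.2} :=
    measurableSet_eq_fun measurable_fst (he.comp measurable_snd)
  have h0 : P.map (fun ω ↦ (S ω, N ω)) {p : γ × β | p.1 = e p.2} = 0 := by
    rw [hprod, Measure.measure_prod_null hm]
    -- By Fubini it is enough that each section is null; injectivity of `e` leaves at most one point
    -- in it.
    refine ae_of_all _ fun s ↦ Set.Subsingleton.measure_zero (fun x hx y hy ↦ ?_) _
    exact hinj ((show s = e x from hx).symm.trans hy)
  rw [Measure.map_apply_of_aemeasurable (hS.prodMk hN) hm] at h0
  rw [ae_iff]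
  simpa using h0

/-- The endpoint of a Brownian motion almost surely differs from the smallest value that keeps the
path above a given countable family of barriers. -/
lemma ProbabilityTheory.IsPreBrownianReal.ae_iSup_ne {X : ℝ≥0 → Ω → ℝ}
    (hX : IsPreBrownianReal X P) {T : ℝ≥0} (hT : T ≠ 0) {ι : Type*} [Countable ι]
    (d : ι → ℝ≥0) (hd : ∀ i, d i ≤ T) (f : ι → ℝ) :
    ∀ᵐ ω ∂P, ⨆ i, ((T / d i * (f i - (X (d i) ω - d i / T * X T ω)) : ℝ) : EReal)
      ≠ (X T ω : EReal) := by
  have := hX.isGaussianProcess.isProbabilityMeasure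
  have mX t := hX.aemeasurable t
  have hatom : NullSingletonClass (P.map (id ∘ X T)) := by
    rw [Function.id_comp]
    rw [(hX.hasLaw_eval T).map_eq]
    exact nullSingletonClass_gaussianReal hT
  -- For `d i > 0`, the bound `X (d i) ≥ f i` is equivalent to `X T ≥ (T / d i) (f i - bridge)`, so
  -- the supremum is a function of the bridge alone. Values in `EReal` spare any bound on the
  -- family.
  have hφ : Measurable fun r : Set.Iic T → ℝ ↦
      ⨆ i, ((T / d i * (f i - r ⟨d i, hd i⟩) : ℝ) : EReal) := by
    refine Measurable.iSup fun i ↦ measurable_coe_real_ereal.comp ?_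
    fun_prop
  refine ((hX.indepFun_bridge hT).comp hφ measurable_id).ae_ne ?_ (mX T)
    measurable_coe_real_ereal EReal.coe_injective
  refine AEMeasurable.iSup fun i ↦ measurable_coe_real_ereal.comp_aemeasurable ?_
  fun_prop

/-- A Brownian path which stays above a continuous floor almost surely does not touch it. -/
lemma ProbabilityTheory.IsPreBrownianReal.ae_lt_of_le {X : ℝ≥0 → Ω → ℝ}
    (hX : IsPreBrownianReal X P) (hcont : ∀ᵐ ω ∂P, Continuous (X · ω)) {A : ℝ} (hA : A < 0)
    {f : Set.Icc A 0 → EReal} (hf : Continuous f)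
    (hf_top : ∀ x, f x ≠ ⊤) (hf_start : f ⟨A, le_rfl, hA.le⟩ < 0) :
    ∀ᵐ ω ∂P, (∀ x : Set.Icc A 0, f x ≤ (X (Real.toNNReal (x - A)) ω : EReal)) →
      ∀ x : Set.Icc A 0, f x < (X (Real.toNNReal (x - A)) ω : EReal) := by
  set T : ℝ≥0 := Real.toNNReal (-A) with hTdef
  have hT : T ≠ 0 := by simp [T, hA]
  have hTpos : 0 < (T : ℝ) := by positivity
  set τ : Set.Icc A 0 → ℝ≥0 := fun x ↦ Real.toNNReal (x - A) with hτdef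
  have hτ (x : Set.Icc A 0) : (τ x : ℝ) = x - A := Real.coe_toNNReal _ (by linarith [x.2.1])
  have hτT (x : Set.Icc A 0) : τ x ≤ T := Real.toNNReal_le_toNNReal (by linarith [x.2.2])
  have hτc : Continuous τ := by fun_prop
  -- Dropping `A` avoids division by `τ = 0`; dropping the points where `f = ⊥` makes `toReal`
  -- faithful.
  obtain ⟨D, hDs, hDc, hDd⟩ := (TopologicalSpace.IsSeparable.of_separableSpace
    {x : Set.Icc A 0 | f x ≠ ⊥ ∧ A < x}).exists_countable_dense_subset
  have := hDc.to_subtype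
  filter_upwards [hX.ae_iSup_ne hT (fun x : D ↦ τ x) (fun x ↦ hτT x) (fun x ↦ (f x).toReal),
    hcont, hX.eval_zero_ae_eq_zero] with ω hne hc h0 hle x
  refine lt_of_le_of_ne (hle x) fun heq ↦ hne ?_
  have hxA : A < x := by
    refine lt_of_le_of_ne x.2.1 fun h ↦ ?_
    have hx : x = ⟨A, le_rfl, hA.le⟩ := Subtype.ext h.symm
    rw [hx] at heq
    simp [heq, h0] at hf_start
  have hxmem : x ∈ {x : Set.Icc A 0 | f x ≠ ⊥ ∧ A < x} := by simp [heq, hxA]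
  -- Staying above the floor bounds every term by `X T`; along `D`, the terms tend to `X T` at the
  -- touching point, so the supremum is exactly `X T`.
  apply le_antisymm
  · refine iSup_le fun y ↦ EReal.coe_le_coe_iff.2 ?_
    have hy := (hDs y.2)
    have hyA : 0 < (τ y : ℝ) := by rw [hτ]; linarith [hy.2]
    have hfy : (f y).toReal ≤ X (τ y) ω := by
      have := hle y
      rw [← EReal.coe_toReal (hf_top y) hy.1] at this
      exact EReal.coe_le_coe_iff.1 this
    rw [div_mul_eq_mul_div, div_le_iff₀ hyA]
    have : (T : ℝ) * ((f y).toReal - (X (τ y) ω - τ y / T * X T ω)) =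
        T * ((f y).toReal - X (τ y) ω) + X T ω * τ y := by field_simp; ring
    rw [this]
    nlinarith
  · have hxD : x ∈ closure D := hDd hxmem
    have : (𝓝[D] x).NeBot := mem_closure_iff_nhdsWithin_neBot.1 hxD
    have hτx : (τ x : ℝ) ≠ 0 := by rw [hτ]; linarith
    have hfx : Tendsto (fun y ↦ (f y).toReal) (𝓝[D] x) (𝓝 (f x).toReal) :=
      ((EReal.tendsto_toReal (hf_top x) hxmem.1).comp (hf.tendsto x)).mono_left nhdsWithin_le_nhds
    have hτt : Tendsto (fun y ↦ (τ y : ℝ)) (𝓝[D] x) (𝓝 (τ x)) :=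
      (Continuous.tendsto (by fun_prop) x).mono_left nhdsWithin_le_nhds
    have hXt : Tendsto (fun y ↦ X (τ y) ω) (𝓝[D] x) (𝓝 (X (τ x) ω)) :=
      ((hc.comp hτc).tendsto x).mono_left nhdsWithin_le_nhds
    have hlim : Tendsto (fun y ↦ T / τ y * ((f y).toReal - (X (τ y) ω - τ y / T * X T ω)))
        (𝓝[D] x) (𝓝 (X T ω)) := by
      have key := ((tendsto_const_nhds (x := (T : ℝ))).div hτt hτx).mul
        (hfx.sub (hXt.sub ((hτt.div_const (T : ℝ)).mul_const (X T ω))))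
      have e : (T : ℝ) / τ x * ((f x).toReal - (X (τ x) ω - τ x / T * X T ω)) = X T ω := by
        rw [heq, EReal.toReal_coe]
        change _ * (X (τ x) ω - (X (τ x) ω - _)) = _
        field_simp
        ring
      rw [e] at key
      exact key
    refine le_of_tendsto (continuous_coe_real_ereal.continuousAt.tendsto.comp hlim) ?_
    filter_upwards [self_mem_nhdsWithin] with y hy
    exact le_iSup (fun y : D ↦ ((T / τ y * ((f y).toReal -
      (X (τ y) ω - τ y / T * X T ω)) : ℝ) : EReal)) ⟨y, hy⟩

/-- A ball around the origin has at least the squared mass of any slightly smaller ball under a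
centered Gaussian measure. -/
lemma ProbabilityTheory.IsGaussian.sq_measure_closedBall_le {E : Type*} [NormedAddCommGroup E]
    [NormedSpace ℝ E] [MeasurableSpace E] [BorelSpace E] [CompleteSpace E]
    [SecondCountableTopology E] (γ : Measure E) [IsGaussian γ] (hγ : γ[id] = 0) (h : E) (r : ℝ) :
    γ (Metric.closedBall h r) ^ 2 ≤ γ (Metric.closedBall 0 (√2 * r)) := by
  -- For independent `x, y` with law `γ`, `(y - x) / √2` again has law `γ`. If both lie within `r`
  -- of `h`, its norm is at most `2r / √2 = √2 r`, and the centre `h` has cancelled.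
  have hrot := IsGaussian.map_rotation_eq_self hγ (Real.pi / 4)
  have hm : MeasurableSet ((Set.univ : Set E) ×ˢ Metric.closedBall (0 : E) (√2 * r)) :=
    MeasurableSet.univ.prod measurableSet_closedBall
  calc γ (Metric.closedBall h r) ^ 2
      = (γ.prod γ) (Metric.closedBall h r ×ˢ Metric.closedBall h r) := by
        rw [Measure.prod_prod, sq]
    _ ≤ (γ.prod γ) (ContinuousLinearMap.rotation (Real.pi / 4) ⁻¹'
          ((Set.univ : Set E) ×ˢ Metric.closedBall (0 : E) (√2 * r))) := by
        refine measure_mono ?_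
        rintro ⟨x, y⟩ ⟨hx, hy⟩
        simp only [Metric.mem_closedBall, dist_eq_norm] at hx hy
        simp only [Set.mem_preimage, ContinuousLinearMap.rotation_apply, Set.mem_prod,
          Set.mem_univ, true_and, mem_closedBall_zero_iff, Real.cos_pi_div_four,
          Real.sin_pi_div_four]
        have : -(√2 / 2) • x + (√2 / 2) • y = (√2 / 2) • ((y - h) - (x - h)) := by
          module
        rw [this, norm_smul, Real.norm_of_nonneg (by positivity)]
        have := norm_sub_le (y - h) (x - h)
        have h2 : (0 : ℝ) ≤ √2 := by positivity
        nlinarith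
    _ = γ (Metric.closedBall 0 (√2 * r)) := by
        rw [← Measure.map_apply (by fun_prop) hm, hrot, Measure.prod_prod]
        simp

/-- A centered Gaussian process with continuous paths on a compact space stays in any
neighbourhood of zero with positive probability. -/
lemma ProbabilityTheory.IsGaussianProcess.measure_forall_abs_le_ne_zero {K : Type*}
    [MetricSpace K] [CompactSpace K] {R : K → Ω → ℝ} (hR : IsGaussianProcess R P)
    (hR0 : ∀ t, P[R t] = 0) (hcont : ∀ᵐ ω ∂P, Continuous (R · ω)) (d : ℕ → K)
    {ε : ℝ} (hε : 0 < ε) : P {ω | ∀ n, |R (d n) ω| ≤ ε} ≠ 0 := by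
  classical
  have := hR.isProbabilityMeasure
  have mR t : AEMeasurable (R t) P := hR.aemeasurable t
  set r := ε / √2 with hr
  have hrpos : 0 < r := by positivity
  -- By separability, countably many balls of radius `r` cover `C(K, ℝ)`, so one of them has
  -- positive mass; its centre is unknown.
  obtain ⟨h, hh⟩ : ∃ h : C(K, ℝ), P {ω | ∀ n, |R (d n) ω - h (d n)| ≤ r} ≠ 0 := by
    by_contra! hcon
    have hnull : P (⋃ k, {ω | ∀ n, |R (d n) ω -
        TopologicalSpace.denseSeq C(K, ℝ) k (d n)| ≤ r}) = 0 :=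
      measure_iUnion_null fun k ↦ hcon _
    have hfull : ∀ᵐ ω ∂P, ω ∈ ⋃ k, {ω | ∀ n, |R (d n) ω -
        TopologicalSpace.denseSeq C(K, ℝ) k (d n)| ≤ r} := by
      filter_upwards [hcont] with ω hω
      obtain ⟨k, hk⟩ := (TopologicalSpace.denseRange_denseSeq C(K, ℝ)).exists_dist_lt
        (⟨fun t ↦ R t ω, hω⟩ : C(K, ℝ)) hrpos
      refine Set.mem_iUnion.2 ⟨k, fun n ↦ ?_⟩
      exact ((ContinuousMap.dist_apply_le_dist (d n)).trans hk.le)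
    have : ∀ᵐ ω ∂P, False := by
      filter_upwards [hfull, measure_eq_zero_iff_ae_notMem.1 hnull] with ω h1 h2 using h2 h1
    exact IsProbabilityMeasure.ne_zero P (by simpa using this)
  -- The small-ball inequality moves the ball to the origin in each finite-dimensional marginal. The
  -- lower bound does not depend on `n`, so it survives the decreasing limit.
  have hfin (n : ℕ) : P {ω | ∀ k, |R (d k) ω - h (d k)| ≤ r} ^ 2
      ≤ P {ω | ∀ k < n, |R (d k) ω| ≤ ε} := by
    set F : Finset K := (Finset.range n).image d
    have hmem (k : ℕ) (hk : k < n) : d k ∈ F := Finset.mem_image_of_mem d (Finset.mem_range.2 hk)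
    have hgauss := hR.hasGaussianLaw F
    have mF : AEMeasurable (fun ω ↦ F.restrict (R · ω)) P := hgauss.aemeasurable
    have := hgauss.isGaussian_map
    have hzero : (P.map (fun ω ↦ F.restrict (R · ω)))[id] = 0 := by
      rw [integral_map mF (by fun_prop)]
      ext t
      refine Eq.trans ?_ (hR0 t)
      exact eval_integral (fun s ↦ (hR.hasGaussianLaw_eval _).integrable) t
    have := IsGaussian.sq_measure_closedBall_le _ hzero (F.restrict h) r
    rw [Measure.map_apply_of_aemeasurable mF measurableSet_closedBall,
      Measure.map_apply_of_aemeasurable mF measurableSet_closedBall] at this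
    refine le_trans (pow_le_pow_left₀ zero_le (measure_mono ?_) 2)
      (this.trans (measure_mono ?_))
    · intro ω hω
      refine (dist_pi_le_iff hrpos.le).2 fun t ↦ ?_
      obtain ⟨k, -, hk⟩ := Finset.mem_image.1 t.2
      have := hω k
      rw [hk] at this
      exact this
    · intro ω hω k hk
      rw [Set.mem_preimage, mem_closedBall_zero_iff, pi_norm_le_iff_of_nonneg (by positivity)] at hω
      have := hω ⟨d k, hmem k hk⟩
      rwa [hr, mul_div_cancel₀ _ (by positivity)] at this
  have hlim := tendsto_measure_iInter_atTop (μ := P)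
    (s := fun n : ℕ ↦ {ω | ∀ k < n, |R (d k) ω| ≤ ε}) (fun n ↦ ?_)
    (fun m n hmn ω hω k hk ↦ hω k (hk.trans_le hmn)) ⟨0, measure_ne_top _ _⟩
  · have hle := ge_of_tendsto' hlim hfin
    have heq : (⋂ n : ℕ, {ω | ∀ k < n, |R (d k) ω| ≤ ε}) = {ω | ∀ k, |R (d k) ω| ≤ ε} := by
      ext ω
      simp only [Set.mem_iInter, Set.mem_ofPred_eq]
      exact ⟨fun H k ↦ H (k + 1) k k.lt_succ_self, fun H n k _ ↦ H k⟩
    rw [heq] at hle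
    intro h0
    rw [h0] at hle
    exact hh (by simpa using hle)
  · have : {ω | ∀ k < n, |R (d k) ω| ≤ ε} = ⋂ k, ⋂ (_ : k < n), {ω | |R (d k) ω| ≤ ε} := by
      ext; simp
    rw [this]
    exact .iInter fun k ↦ .iInter fun _ ↦ nullMeasurableSet_le (by fun_prop) (by fun_prop)

/-- A Brownian path stays close to any given line with positive probability. -/
lemma ProbabilityTheory.IsPreBrownianReal.measure_forall_abs_sub_le_ne_zero {X : ℝ≥0 → Ω → ℝ}
    (hX : IsPreBrownianReal X P) (hcont : ∀ᵐ ω ∂P, Continuous (X · ω)) {A : ℝ} (hA : A < 0)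
    (c : ℝ) (d : ℕ → Set.Icc A 0) {ε : ℝ} (hε : 0 < ε) :
    P {ω | ∀ n, |X (Real.toNNReal (d n - A)) ω - c * (d n - A)| ≤ ε} ≠ 0 := by
  have := hX.isGaussianProcess.isProbabilityMeasure
  set T : ℝ≥0 := Real.toNNReal (-A) with hTdef
  have hT : T ≠ 0 := by simp [T, hA]
  have hTpos : 0 < (T : ℝ) := by positivity
  set τ : Set.Icc A 0 → ℝ≥0 := fun x ↦ Real.toNNReal (x - A) with hτdef
  have hτ (x : Set.Icc A 0) : (τ x : ℝ) = x - A := Real.coe_toNNReal _ (by linarith [x.2.1])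
  have hτT (x : Set.Icc A 0) : τ x ≤ T := Real.toNNReal_le_toNNReal (by linarith [x.2.2])
  have hτc : Continuous τ := by fun_prop
  -- The bridge is centered, so it is small with positive probability. The slope `c` is carried
  -- entirely by the independent endpoint, whose nondegenerate Gaussian law charges every interval.
  have hbridge : P {ω | ∀ n, |X (τ (d n)) ω - τ (d n) / T * X T ω| ≤ ε / 2} ≠ 0 := by
    refine IsGaussianProcess.measure_forall_abs_le_ne_zero
      (R := fun x ω ↦ X (τ x) ω - τ x / T * X T ω) ?_ ?_ ?_ d (half_pos hε)
    · classical
      refine hX.isGaussianProcess.of_isGaussianProcess fun x ↦ ⟨{τ x, T},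
          { toFun y := y ⟨τ x, by simp⟩ - τ x / T * y ⟨T, by simp⟩
            map_add' x y := by simp; ring
            map_smul' c x := by simp; ring }, by simp⟩
    · intro x
      rw [integral_sub (hX.integrable_eval _) ((hX.integrable_eval _).const_mul _),
        integral_const_mul, hX.integral_eval, hX.integral_eval]
      simp
    · filter_upwards [hcont] with ω hω
      have h1 : Continuous fun x ↦ X (τ x) ω := hω.comp hτc
      fun_prop
  have hend : P {ω | |X T ω - c * T| ≤ ε / 2} ≠ 0 := by
    have h1 : P.map (X T) (Metric.closedBall (c * T) (ε / 2)) ≠ 0 := by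
      rw [(hX.hasLaw_eval T).map_eq]
      intro h0
      have := gaussianReal_absolutelyContinuous' 0 hT h0
      simp only [Real.volume_closedBall, ENNReal.ofReal_eq_zero] at this
      linarith
    rwa [Measure.map_apply_of_aemeasurable (hX.aemeasurable T) measurableSet_closedBall] at h1
  have hind := (hX.indepFun_bridge hT).measure_inter_preimage_eq_mul
    {r | ∀ n, |r ⟨τ (d n), hτT _⟩| ≤ ε / 2} {y | |y - c * T| ≤ ε / 2}
    (by
      simp only [Set.ofPred_forall]
      exact MeasurableSet.iInter fun n ↦ measurableSet_le (by fun_prop) measurable_const)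
    (measurableSet_le (by fun_prop) measurable_const)
  intro h0
  refine mul_ne_zero hbridge hend (hind.symm.trans (measure_mono_null ?_ h0))
  rintro ω ⟨h1, h2⟩ n
  have h1 := h1 n
  simp only [Set.mem_preimage, Set.mem_ofPred_eq] at h1 h2
  have h3 : (τ (d n) : ℝ) / T ≤ 1 := (div_le_one hTpos).2 (by exact_mod_cast hτT (d n))
  have h4 : (0 : ℝ) ≤ τ (d n) / T := by positivity
  change |X (τ (d n)) ω - c * (d n - A)| ≤ ε
  rw [← hτ]
  calc |X (τ (d n)) ω - c * τ (d n)|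
      = |(X (τ (d n)) ω - τ (d n) / T * X T ω) + τ (d n) / T * (X T ω - c * T)| := by
        congr 1
        field_simp
        ring
    _ ≤ ε / 2 + 1 * (ε / 2) := by
        refine (abs_add_le _ _).trans (add_le_add h1 ?_)
        rw [abs_mul, abs_of_nonneg h4]
        exact mul_le_mul h3 h2 (abs_nonneg _) zero_le_one
    _ = ε := by ring

/-- The difference of two independent Brownian motions, rescaled by `1 / √2`, is a Brownian
motion. -/
lemma ProbabilityTheory.IsPreBrownianReal.sub_div_sqrt_two {X Y : ℝ≥0 → Ω → ℝ}
    (hX : IsPreBrownianReal X P) (hY : IsPreBrownianReal Y P)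
    (hXY : IndepFun (fun ω t ↦ X t ω) (fun ω t ↦ Y t ω) P) :
    IsPreBrownianReal (fun t ω ↦ (√2)⁻¹ * (X t ω - Y t ω)) P := by
  have := hX.isGaussianProcess.isProbabilityMeasure
  have hmX t : MemLp (X t) 2 P := (hX.isGaussianProcess.hasGaussianLaw_eval t).memLp_two
  have hmY t : MemLp (Y t) 2 P := (hY.isGaussianProcess.hasGaussianLaw_eval t).memLp_two
  have hst s t : cov[X s, Y t; P] = 0 :=
    (hXY.comp (measurable_pi_apply s) (measurable_pi_apply t)).covariance_eq_zero (hmX s) (hmY t)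
  have hts s t : cov[Y s, X t; P] = 0 := by rw [covariance_comm, hst]
  refine IsGaussianProcess.isPreBrownianReal_of_covariance ?_ (fun t ↦ ?_) (fun s t hle ↦ ?_)
  · refine IsGaussianProcess.smul (fun _ ↦ (√2)⁻¹) (X := fun t ω ↦ X t ω - Y t ω) ⟨fun I ↦ ?_⟩
    have hI : IndepFun (fun ω ↦ I.restrict (X · ω)) (fun ω ↦ I.restrict (Y · ω)) P :=
      hXY.comp (Finset.measurable_restrict I) (Finset.measurable_restrict I)
    exact iIndepFun.hasGaussianLaw_fun_sub (hX.isGaussianProcess.hasGaussianLaw I)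
      (hY.isGaussianProcess.hasGaussianLaw I) hI
  · rw [integral_const_mul, integral_sub (hX.integrable_eval t) (hY.integrable_eval t),
      hX.integral_eval, hY.integral_eval]
    simp
  · rw [covariance_const_mul_left, covariance_const_mul_right,
      covariance_fun_sub_left (Z := fun ω ↦ X t ω - Y t ω) (hmX s) (hmY s)
        ((hmX t).sub (hmY t)),
      covariance_fun_sub_right (hmX s) (hmX t) (hmY t),
      covariance_fun_sub_right (hmY s) (hmX t) (hmY t), hX.covariance_eval, hY.covariance_eval,
      hst, hts, min_eq_left hle, ← mul_assoc, ← mul_inv, Real.mul_self_sqrt zero_le_two]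
    ring

end Gaussian

/-! ### Measurability of random paths. -/

section PathMeasurability

/-- A random continuous function on a compact space is a.e. measurable as soon as its values at
each point are. -/
lemma ContinuousMap.aemeasurable_of_forall_eval {Ω K E : Type*} [MeasurableSpace Ω] {P : Measure Ω}
    [MetricSpace K] [CompactSpace K] [NormedAddCommGroup E] [CompleteSpace E]
    [SecondCountableTopology E] [MeasurableSpace E] [BorelSpace E]
    [MeasurableSpace C(K, E)] [BorelSpace C(K, E)] {f : Ω → C(K, E)}
    (hf : ∀ x, AEMeasurable (fun ω ↦ f ω x) P) : AEMeasurable f P := by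
  obtain ⟨D, hDc, hDd⟩ := TopologicalSpace.exists_countable_dense K
  have := hDc.to_subtype
  have hev : Continuous fun (h : C(K, E)) (x : D) ↦ h x := by fun_prop
  have hinj : Function.Injective fun (h : C(K, E)) (x : D) ↦ h x := fun h₁ h₂ h ↦
    DFunLike.coe_injective (h₁.continuous.ext_on hDd h₂.continuous fun x hx ↦ congrFun h ⟨x, hx⟩)
  -- Lusin–Souslin: a measurable injection from the Polish space `C(K, E)` into a countable product
  -- is a measurable embedding.
  refine (hev.measurable.measurableEmbedding hinj).aemeasurable_comp_iff.1 ?_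
  exact aemeasurable_pi_lambda _ fun x ↦ hf x

variable {Ω : Type*} {n : ℕ} {W : Fin n → ℝ≥0 → Ω → ℝ}

lemma driftedTrajectory_continuous {ω : Ω} (hω : ∀ i, Continuous (W i · ω)) (A : ℝ)
    (a v : Fin n → ℝ) : Continuous (driftedTrajectory W A a v ω) := by
  refine continuous_pi fun i ↦ ?_
  have h := (hω i).comp (f := fun x : Set.Icc A 0 ↦ Real.toNNReal ((x : ℝ) - A)) (by fun_prop)
  simp only [driftedTrajectory]
  exact Continuous.add (by fun_prop) h

lemma driftedPath_apply {ω : Ω} (hω : ∀ i, Continuous (W i · ω)) (A : ℝ)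
    (a v : Fin n → ℝ) (x : Set.Icc A 0) (i : Fin n) :
    driftedPath W A a v ω x i =
      a i + v i * ((x : ℝ) - A) + W i (Real.toNNReal ((x : ℝ) - A)) ω := by
  rw [driftedPath, dif_pos (driftedTrajectory_continuous hω A a v)]
  rfl

/-- With the noise fixed, changing the start translates the path, so convergence of starting points
gives uniform convergence of paths. -/
lemma driftedPath_eq_const_add {ω : Ω} (hω : ∀ i, Continuous (W i · ω)) (A : ℝ)
    (a v : Fin n → ℝ) :
    driftedPath W A a v ω = ContinuousMap.const _ a + driftedPath W A 0 v ω := by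
  ext x i
  simp [driftedPath_apply hω, add_assoc]

lemma aemeasurable_driftedPath [MeasurableSpace Ω] {P : Measure Ω}
    (hW : ∀ i, IsBrownianReal (W i) P) (A : ℝ) (a v : Fin n → ℝ) :
    AEMeasurable (driftedPath W A a v) P := by
  refine ContinuousMap.aemeasurable_of_forall_eval fun x ↦ aemeasurable_pi_lambda _ fun i ↦ ?_
  have h : AEMeasurable
      (fun ω ↦ a i + v i * ((x : ℝ) - A) + W i (Real.toNNReal ((x : ℝ) - A)) ω) P :=
    ((hW i).aemeasurable _).const_add _
  refine h.congr ?_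
  filter_upwards [ae_all_iff.2 fun i ↦ (hW i).cont] with ω hω
  rw [driftedPath_apply hω]

end PathMeasurability

/-! ### Asymptotics of the penalty. -/

noncomputable section Weights

/-- Lebesgue measure on `[A, 0]`. -/
abbrev intervalVolume (A : ℝ) : Measure (Set.Icc A 0) := volume.comap Subtype.val

instance intervalVolume.instIsFiniteMeasure (A : ℝ) : IsFiniteMeasure (intervalVolume A) where
  measure_univ_lt_top := by
    rw [comap_subtype_coe_apply measurableSet_Icc, Set.image_univ, Subtype.range_coe]
    exact measure_Icc_lt_top

/-- A relatively open set may contain an endpoint of `[A, 0]`; since `(A, 0)` is dense there, it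
still meets the open interval in a nonempty open set. -/
lemma intervalVolume_pos_of_isOpen {A : ℝ} (hA : A < 0) {U : Set (Set.Icc A 0)} (hU : IsOpen U)
    (hne : U.Nonempty) : 0 < intervalVolume A U := by
  obtain ⟨V, hV, rfl⟩ := isOpen_induced_iff.1 hU
  obtain ⟨x, hx⟩ := hne
  rw [comap_subtype_coe_apply measurableSet_Icc, Subtype.image_preimage_coe]
  have hcl : (x : ℝ) ∈ closure (Set.Ioo A 0) := by rw [closure_Ioo hA.ne]; exact x.2
  have hne : (V ∩ Set.Ioo A 0).Nonempty := mem_closure_iff.1 hcl V hV hx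
  refine ((hV.inter isOpen_Ioo).measure_pos volume hne).trans_le (measure_mono ?_)
  rintro y ⟨hy, hy'⟩
  exact ⟨Set.Ioo_subset_Icc_self hy', hy⟩

/-- The penalty `L ∫ u ^ √L` for a function `u` on `[A, 0]`. -/
def penalty {A : ℝ} (L : ℝ) (u : C(Set.Icc A 0, ℝ)) : ℝ :=
  L * ∫ x, u x ^ √L ∂intervalVolume A

lemma integrable_rpow {A : ℝ} (L : ℝ) (u : C(Set.Icc A 0, ℝ)) :
    Integrable (fun x ↦ u x ^ √L) (intervalVolume A) :=
  Continuous.integrable_of_hasCompactSupport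
    (u.continuous.rpow_const fun _ ↦ Or.inr (Real.sqrt_nonneg L)) (.of_compactSpace _)

lemma continuous_penalty {A : ℝ} (L : ℝ) : Continuous (penalty (A := A) L) := by
  refine continuous_const.mul ?_
  have hpow : Continuous fun u : C(Set.Icc A 0, ℝ) ↦
      (⟨fun y : ℝ ↦ y ^ √L, Real.continuous_rpow_const (Real.sqrt_nonneg L)⟩ : C(ℝ, ℝ)).comp u :=
    ContinuousMap.continuous_postcomp _
  exact ((ContinuousMap.toLp (E := ℝ) 1 (intervalVolume A) ℝ).continuous.comp hpow |>
    continuous_integral.comp).congr fun u ↦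
      integral_congr_ae (ContinuousMap.coeFn_toLp _ _)

lemma penalty_nonneg {A L : ℝ} (hL : 0 ≤ L) {u : C(Set.Icc A 0, ℝ)} (hu : ∀ x, 0 ≤ u x) :
    0 ≤ penalty L u :=
  mul_nonneg hL (integral_nonneg fun x ↦ Real.rpow_nonneg (hu x) _)

variable {ι : Type*} {l : Filter ι} {A : ℝ} {Λ : ι → ℝ} {u : ι → C(Set.Icc A 0, ℝ)}
  {u₀ : C(Set.Icc A 0, ℝ)}

/-- Compactness gives `max u₀ < r < 1`, and uniform convergence then gives `u i ≤ r` eventually. The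
penalty is at most a constant times `Λ r^√Λ`, that is `s² exp (s log r)` with `s = √Λ`. -/
lemma tendsto_penalty_of_lt_one (hA : A < 0) (hΛ : Tendsto Λ l atTop) (hu : Tendsto u l (𝓝 u₀))
    (hpos : ∀ i x, 0 ≤ u i x) (hlt : ∀ x, u₀ x < 1) :
    Tendsto (fun i ↦ penalty (Λ i) (u i)) l (𝓝 0) := by
  have hne : Nonempty (Set.Icc A 0) := ⟨⟨A, le_rfl, hA.le⟩⟩
  obtain ⟨x₀, -, hx₀⟩ := isCompact_univ.exists_isMaxOn Set.univ_nonempty u₀.continuous.continuousOn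
  obtain ⟨r, hr₀, hr₁⟩ := exists_between (max_lt (hlt x₀) zero_lt_one)
  have hr₀' : 0 < r := (le_max_right _ _).trans_lt hr₀
  have hr : 0 < r - u₀ x₀ := sub_pos.2 ((le_max_left _ _).trans_lt hr₀)
  have hev : ∀ᶠ i in l, ∀ x, u i x ≤ r := by
    filter_upwards [(Metric.tendsto_nhds.1 hu) _ hr] with i hi x
    have h1 := (ContinuousMap.dist_apply_le_dist x).trans_lt hi
    have h2 : u₀ x ≤ u₀ x₀ := hx₀ (Set.mem_univ x)
    rw [Real.dist_eq] at h1
    linarith [le_abs_self (u i x - u₀ x)]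
  have hsqrt : Tendsto (fun i ↦ √(Λ i)) l atTop := Real.tendsto_sqrt_atTop.comp hΛ
  have hlim : Tendsto (fun i ↦ √(Λ i) ^ (2 : ℝ) * Real.exp (-(-Real.log r) * √(Λ i)) *
      (intervalVolume A).real Set.univ) l (𝓝 0) := by
    simpa using ((tendsto_rpow_mul_exp_neg_mul_atTop_nhds_zero 2 (-Real.log r)
      (by linarith [Real.log_neg hr₀' hr₁])).comp hsqrt).mul_const
        ((intervalVolume A).real Set.univ)
  refine tendsto_of_tendsto_of_tendsto_of_le_of_le' tendsto_const_nhds hlim ?_ ?_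
  · filter_upwards [hΛ.eventually_ge_atTop 0] with i hi using penalty_nonneg hi (hpos i)
  · filter_upwards [hΛ.eventually_ge_atTop 0, hev] with i hi hle
    have hint : ∫ x, u i x ^ √(Λ i) ∂intervalVolume A ≤ ∫ _, r ^ √(Λ i) ∂intervalVolume A :=
      integral_mono (integrable_rpow _ _) (integrable_const _) fun x ↦
        Real.rpow_le_rpow (hpos i x) (hle x) (Real.sqrt_nonneg _)
    rw [integral_const, smul_eq_mul, Real.rpow_def_of_pos hr₀'] at hint
    calc penalty (Λ i) (u i) ≤ Λ i * _ := mul_le_mul_of_nonneg_left hint hi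
      _ = _ := by
        rw [Real.rpow_two, Real.sq_sqrt hi]
        ring_nf

/-- With `1 < r < u₀ x₀`, eventually `u i ≥ 1` on the open set `{u₀ > r}`, so the penalty is at
least `Λ` times the positive length of that set. -/
lemma tendsto_penalty_of_one_lt (hA : A < 0) (hΛ : Tendsto Λ l atTop) (hu : Tendsto u l (𝓝 u₀))
    (hpos : ∀ i x, 0 ≤ u i x) {x₀ : Set.Icc A 0} (hlt : 1 < u₀ x₀) :
    Tendsto (fun i ↦ penalty (Λ i) (u i)) l atTop := by
  obtain ⟨r, hr₁, hr₀⟩ := exists_between hlt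
  set U : Set (Set.Icc A 0) := {x | r < u₀ x}
  have hU : IsOpen U := isOpen_lt continuous_const u₀.continuous
  have hUpos : 0 < (intervalVolume A).real U :=
    ENNReal.toReal_pos (intervalVolume_pos_of_isOpen hA hU ⟨x₀, hr₀⟩).ne' (measure_ne_top _ _)
  refine tendsto_atTop_mono' l ?_ (hΛ.atTop_mul_const hUpos)
  filter_upwards [hΛ.eventually_ge_atTop 0, (Metric.tendsto_nhds.1 hu) _ (sub_pos.2 hr₁)]
    with i hi hdist
  refine mul_le_mul_of_nonneg_left ?_ hi
  calc (intervalVolume A).real U = ∫ _ in U, (1 : ℝ) ∂intervalVolume A := by simp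
    _ ≤ ∫ x in U, u i x ^ √(Λ i) ∂intervalVolume A := by
      refine setIntegral_mono_on (integrable_const _).integrableOn
        (integrable_rpow _ _).integrableOn hU.measurableSet fun x hx ↦ ?_
      refine Real.one_le_rpow ?_ (Real.sqrt_nonneg _)
      have h1 := (ContinuousMap.dist_apply_le_dist x).trans_lt hdist
      have h2 : r < u₀ x := hx
      rw [Real.dist_eq] at h1
      linarith [neg_abs_le (u i x - u₀ x)]
    _ ≤ ∫ x, u i x ^ √(Λ i) ∂intervalVolume A :=
      setIntegral_le_integral (integrable_rpow _ _)
        (ae_of_all _ fun x ↦ Real.rpow_nonneg (hpos i x) _)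

/-! ### Exponentiated gaps and limits of the Gibbs weight. -/

/-- The function `exp (B_{i+1} - B_i)` on `[A, 0]`, where `B_0 = ∞` and the exponential of
`B_{n+1}` is `G`. -/
def gapExp {A : ℝ} {n : ℕ} (G : C(Set.Icc A 0, ℝ)) (B : PathSpace A n) : ℕ → C(Set.Icc A 0, ℝ)
  | 0 => 0
  | j + 1 =>
    if h : j + 1 < n then
      (⟨fun y : Fin n → ℝ ↦ Real.exp (y ⟨j + 1, h⟩ - y ⟨j, by omega⟩), by fun_prop⟩ :
        C(Fin n → ℝ, ℝ)).comp B
    -- The floor enters only through its exponential `G`, so the value `-∞` is simply `G = 0`.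
    -- Indices beyond `n` get the default 0.
    else if h' : j < n then
      G * (⟨fun y : Fin n → ℝ ↦ Real.exp (-y ⟨j, h'⟩), by fun_prop⟩ : C(Fin n → ℝ, ℝ)).comp B
    else 0

lemma continuous_gapExp {A : ℝ} {n : ℕ} (i : ℕ) :
    Continuous fun p : C(Set.Icc A 0, ℝ) × PathSpace A n ↦ gapExp p.1 p.2 i := by
  rcases i with _ | j
  · exact continuous_const
  · simp only [gapExp]
    split_ifs
    · exact (ContinuousMap.continuous_postcomp _).comp continuous_snd
    · exact continuous_fst.mul ((ContinuousMap.continuous_postcomp _).comp continuous_snd)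
    · exact continuous_const

lemma gapExp_nonneg {A : ℝ} {n : ℕ} {G : C(Set.Icc A 0, ℝ)} (hG : ∀ x, 0 ≤ G x)
    (B : PathSpace A n) (i : ℕ) (x : Set.Icc A 0) : 0 ≤ gapExp G B i x := by
  rcases i with _ | j
  · exact le_rfl
  · simp only [gapExp]
    split_ifs
    · exact (Real.exp_pos _).le
    · exact mul_nonneg (hG x) (Real.exp_pos _).le
    · exact le_rfl

/-- The exponential of a floor with values in `[-∞, ∞)`. -/
def expFloor {A : ℝ} (g : Set.Icc A 0 → EReal) (hg : Continuous g) (hg_top : ∀ x, g x ≠ ⊤) :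
    C(Set.Icc A 0, ℝ) :=
  ⟨fun x ↦ (EReal.exp (g x)).toReal, continuous_iff_continuousAt.2 fun x ↦
    (ENNReal.tendsto_toReal (by simpa using hg_top x)).comp
      (ENNReal.continuous_exp.comp hg).continuousAt⟩

/-- Bridges the extended-real integrand and real powers. At `u = ⊥` it reads `0 = 0 ^ s`, which
needs `s ≠ 0`. -/
lemma toReal_exp_mul_sub {u : EReal} (hu : u ≠ ⊤) (v : ℝ) {s : ℝ} (hs : 0 < s) :
    (EReal.exp (s * (u - v))).toReal = ((EReal.exp u).toReal * Real.exp (-v)) ^ s := by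
  induction u with
  | bot => simp [EReal.coe_mul_bot_of_pos hs, hs.ne']
  | top => exact absurd rfl hu
  | coe u =>
    rw [← EReal.coe_sub, ← EReal.coe_mul, EReal.exp_coe, EReal.exp_coe,
      ENNReal.toReal_ofReal (Real.exp_pos _).le, ENNReal.toReal_ofReal (Real.exp_pos _).le,
      ← Real.exp_add, ← Real.exp_mul]
    ring_nf

lemma toReal_exp_mul_exp_neg_lt_one {u : EReal} (hu : u ≠ ⊤) (v : ℝ) :
    (EReal.exp u).toReal * Real.exp (-v) < 1 ↔ u < v := by
  induction u with
  | bot => simp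
  | top => exact absurd rfl hu
  | coe u =>
    rw [EReal.exp_coe, ENNReal.toReal_ofReal (Real.exp_pos _).le, ← Real.exp_add,
      Real.exp_lt_one_iff, EReal.coe_lt_coe_iff, ← sub_eq_add_neg, sub_neg]

lemma one_lt_toReal_exp_mul_exp_neg {u : EReal} (hu : u ≠ ⊤) (v : ℝ) :
    1 < (EReal.exp u).toReal * Real.exp (-v) ↔ v < u := by
  induction u with
  | bot => simp
  | top => exact absurd rfl hu
  | coe u =>
    rw [EReal.exp_coe, ENNReal.toReal_ofReal (Real.exp_pos _).le, ← Real.exp_add,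
      Real.one_lt_exp_iff, EReal.coe_lt_coe_iff, ← sub_eq_add_neg, sub_pos]

variable {n : ℕ} {g : Set.Icc A 0 → EReal}

lemma curve_ne_top (hg_top : ∀ x, g x ≠ ⊤) (B : PathSpace A n) (i : ℕ) (x : Set.Icc A 0) :
    curve B g (i + 1) x ≠ ⊤ := by
  simp only [curve]
  split_ifs
  · exact EReal.coe_ne_top _
  · exact hg_top x

lemma curve_succ_of_lt (B : PathSpace A n) {i : ℕ} (hi : i < n) (x : Set.Icc A 0) :
    curve B g (i + 1) x = (B x ⟨i, hi⟩ : ℝ) := dif_pos hi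

lemma gapExp_apply (hg : Continuous g) (hg_top : ∀ x, g x ≠ ⊤) (B : PathSpace A n) {i : ℕ}
    (hi : i < n) (x : Set.Icc A 0) :
    gapExp (expFloor g hg hg_top) B (i + 1) x =
      (EReal.exp (curve B g (i + 2) x)).toReal * Real.exp (-B x ⟨i, hi⟩) := by
  by_cases h : i + 1 < n
  · rw [curve_succ_of_lt B h, EReal.exp_coe, ENNReal.toReal_ofReal (Real.exp_pos _).le,
      ← Real.exp_add]
    simp [gapExp, h, sub_eq_add_neg]
  · simp [gapExp, h, hi, expFloor, curve]

lemma gibbsWeight_eq (hg : Continuous g) (hg_top : ∀ x, g x ≠ ⊤) (hn : 0 < n) {L : ℝ}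
    (hL : 0 < L) (B : PathSpace A n) :
    gibbsWeight L g B = Real.exp
      (-∑ i ∈ Finset.range (n + 1), penalty L (gapExp (expFloor g hg hg_top) B i)) := by
  rw [gibbsWeight, ← Finset.sum_neg_distrib, Real.exp_sum]
  refine Finset.prod_congr rfl fun i hi ↦ ?_
  rw [penalty, neg_mul]
  congr 3
  refine integral_congr_ae (ae_of_all _ fun x ↦ ?_)
  have hs := Real.sqrt_pos.2 hL
  rcases i with _ | i
  · have h1 : curve B g (0 + 1) x - curve B g 0 x = ⊥ := by
      rw [curve_succ_of_lt B hn]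
      rfl
    simp only [h1, EReal.coe_mul_bot_of_pos hs, EReal.exp_bot, ENNReal.toReal_zero, gapExp]
    exact (Real.zero_rpow hs.ne').symm
  · have hi : i < n := by simpa using hi
    simp only
    rw [gapExp_apply hg hg_top B hi, curve_succ_of_lt B hi,
      toReal_exp_mul_sub (curve_ne_top hg_top _ _ _) _ hs]

lemma continuous_gibbsWeight (hg : Continuous g) (hg_top : ∀ x, g x ≠ ⊤) (hn : 0 < n) {L : ℝ}
    (hL : 0 < L) : Continuous (gibbsWeight (A := A) (n := n) L g) := by
  rw [funext (gibbsWeight_eq hg hg_top hn hL)]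
  refine Real.continuous_exp.comp (Continuous.neg (continuous_finsetSum _ fun i _ ↦ ?_))
  exact (continuous_penalty L).comp
    ((continuous_gapExp i).comp (Continuous.prodMk continuous_const continuous_id))

lemma gibbsWeight_pos (L : ℝ) (B : PathSpace A n) : 0 < gibbsWeight L g B :=
  Finset.prod_pos fun _ _ ↦ Real.exp_pos _

lemma gibbsWeight_le_one {L : ℝ} (hL : 0 ≤ L) (B : PathSpace A n) : gibbsWeight L g B ≤ 1 :=
  Finset.prod_le_one (fun _ _ ↦ (Real.exp_pos _).le) fun _ _ ↦ by
    rw [Real.exp_le_one_iff, neg_mul, neg_nonpos]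
    exact mul_nonneg hL (integral_nonneg fun _ ↦ ENNReal.toReal_nonneg)

lemma mem_nonIntersecting_iff (hg : Continuous g) (hg_top : ∀ x, g x ≠ ⊤) (B : PathSpace A n) :
    B ∈ nonIntersecting g ↔ ∀ i < n + 1, ∀ x, gapExp (expFloor g hg hg_top) B i x < 1 := by
  constructor
  · rintro hB (_ | i) hi x
    · exact zero_lt_one
    · have hi : i < n := by omega
      have := hB x (i + 1) (Finset.mem_Icc.2 ⟨by omega, by omega⟩)
      rw [gapExp_apply hg hg_top B hi, toReal_exp_mul_exp_neg_lt_one (curve_ne_top hg_top _ _ _)]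
      rwa [curve_succ_of_lt B hi] at this
  · rintro hB x i hi
    obtain ⟨h1, h2⟩ := Finset.mem_Icc.1 hi
    obtain ⟨i, rfl⟩ := Nat.exists_eq_succ_of_ne_zero (by omega : i ≠ 0)
    have hi : i < n := by omega
    have := hB (i + 1) (by omega) x
    rw [gapExp_apply hg hg_top B hi,
      toReal_exp_mul_exp_neg_lt_one (curve_ne_top hg_top _ _ _)] at this
    rwa [curve_succ_of_lt B hi]

/-- On the compact interval, `u < 1` everywhere is an open condition in the uniform topology, and
the gaps depend continuously on the path. -/
lemma isOpen_nonIntersecting (hg : Continuous g) (hg_top : ∀ x, g x ≠ ⊤) :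
    IsOpen (nonIntersecting (A := A) (n := n) g) := by
  have : nonIntersecting (A := A) (n := n) g = ⋂ i ∈ Finset.range (n + 1),
      (fun B ↦ gapExp (expFloor g hg hg_top) B i) ⁻¹'
        {u | Set.MapsTo u Set.univ (Set.Iio (1 : ℝ))} := by
    ext B
    simp [mem_nonIntersecting_iff hg hg_top, Set.MapsTo]
  rw [this]
  refine isOpen_biInter_finset fun i _ ↦ IsOpen.preimage ?_
    (ContinuousMap.isOpen_setOfPred_mapsTo isCompact_univ isOpen_Iio)
  exact (continuous_gapExp i).comp (Continuous.prodMk continuous_const continuous_id)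

variable {gL : ι → Set.Icc A 0 → EReal} {B : ι → PathSpace A n} {B₀ : PathSpace A n}

lemma tendsto_gapExp (hg : Continuous g) (hg_top : ∀ x, g x ≠ ⊤)
    (hgL : ∀ L, Continuous (gL L)) (hgL_top : ∀ L x, gL L x ≠ ⊤)
    (hlim : FloorsTendstoUniformly gL g l) (hB : Tendsto B l (𝓝 B₀)) (i : ℕ) :
    Tendsto (fun L ↦ gapExp (expFloor (gL L) (hgL L) (hgL_top L)) (B L) i) l
      (𝓝 (gapExp (expFloor g hg hg_top) B₀ i)) := by
  have hG : Tendsto (fun L ↦ expFloor (gL L) (hgL L) (hgL_top L)) l (𝓝 (expFloor g hg hg_top)) :=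
    ContinuousMap.tendsto_iff_tendstoUniformly.2 hlim
  exact ((continuous_gapExp i).tendsto (expFloor g hg hg_top, B₀)).comp (hG.prodMk_nhds hB)

lemma tendsto_gibbsWeight_of_mem (hA : A < 0) (hn : 0 < n) (hΛ : Tendsto Λ l atTop)
    (hΛ_pos : ∀ i, 0 < Λ i) (hg : Continuous g) (hg_top : ∀ x, g x ≠ ⊤)
    (hgL : ∀ L, Continuous (gL L)) (hgL_top : ∀ L x, gL L x ≠ ⊤)
    (hlim : FloorsTendstoUniformly gL g l) (hB : Tendsto B l (𝓝 B₀))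
    (hmem : B₀ ∈ nonIntersecting g) :
    Tendsto (fun L ↦ gibbsWeight (Λ L) (gL L) (B L)) l (𝓝 1) := by
  simp_rw [fun L ↦ gibbsWeight_eq (hgL L) (hgL_top L) hn (hΛ_pos L) (B L)]
  rw [mem_nonIntersecting_iff hg hg_top] at hmem
  have := tendsto_finsetSum (Finset.range (n + 1)) fun i hi ↦ tendsto_penalty_of_lt_one hA hΛ
    (tendsto_gapExp hg hg_top hgL hgL_top hlim hB i)
    (fun L ↦ gapExp_nonneg (fun _ ↦ ENNReal.toReal_nonneg) _ _)
    (hmem i (Finset.mem_range.1 hi))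
  simpa using! (Real.continuous_exp.tendsto _).comp this.neg

/-- One diverging penalty suffices, because the others are nonnegative and cannot compensate for it.
-/
lemma tendsto_gibbsWeight_of_curve_lt (hA : A < 0) (hn : 0 < n) (hΛ : Tendsto Λ l atTop)
    (hΛ_pos : ∀ i, 0 < Λ i) (hg : Continuous g) (hg_top : ∀ x, g x ≠ ⊤)
    (hgL : ∀ L, Continuous (gL L)) (hgL_top : ∀ L x, gL L x ≠ ⊤)
    (hlim : FloorsTendstoUniformly gL g l) (hB : Tendsto B l (𝓝 B₀)) {i : ℕ} (hi : i < n)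
    {x : Set.Icc A 0} (hlt : curve B₀ g (i + 1) x < curve B₀ g (i + 2) x) :
    Tendsto (fun L ↦ gibbsWeight (Λ L) (gL L) (B L)) l (𝓝 0) := by
  simp_rw [fun L ↦ gibbsWeight_eq (hgL L) (hgL_top L) hn (hΛ_pos L) (B L)]
  have hpos : ∀ j L, ∀ x, 0 ≤ gapExp (expFloor (gL L) (hgL L) (hgL_top L)) (B L) j x :=
    fun j L ↦ gapExp_nonneg (fun _ ↦ ENNReal.toReal_nonneg) _ _
  have hgap : 1 < gapExp (expFloor g hg hg_top) B₀ (i + 1) x := by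
    rw [gapExp_apply hg hg_top B₀ hi, one_lt_toReal_exp_mul_exp_neg (curve_ne_top hg_top _ _ _)]
    rwa [curve_succ_of_lt B₀ hi] at hlt
  have := tendsto_penalty_of_one_lt hA hΛ
    (tendsto_gapExp hg hg_top hgL hgL_top hlim hB (i + 1)) (hpos _) hgap
  refine Real.tendsto_exp_neg_atTop_nhds_zero.comp (tendsto_atTop_mono (fun L ↦ ?_) this)
  exact Finset.single_le_sum
    (f := fun j ↦ penalty (Λ L) (gapExp (expFloor (gL L) (hgL L) (hgL_top L)) (B L) j))
    (fun j _ ↦ penalty_nonneg (hΛ_pos L).le (hpos j L)) (Finset.mem_range.2 (by omega))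

end Weights

/-! ### Non-intersection: almost sure dichotomy and positive probability. -/

section Trajectories

variable {Ω : Type*} [MeasurableSpace Ω] {P : Measure Ω} {n : ℕ} {W : Fin n → ℝ≥0 → Ω → ℝ}
  {A : ℝ} {a : Fin n → ℝ} {g : Set.Icc A 0 → EReal}

/-- Almost surely, consecutive curves of a family of drifted Brownian motions with a floor do not
touch without crossing. -/
lemma ae_driftedPath_mem_nonIntersecting_or (hW : ∀ i, IsBrownianReal (W i) P)
    (hW_indep : iIndepFun (fun i ω t ↦ W i t ω) P) (hA : A < 0) (ha : StrictAnti a)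
    (v : Fin n → ℝ) (hg_cont : Continuous g) (hg_top : ∀ x, g x ≠ ⊤)
    (hg_start : ∀ i : Fin n, (i : ℕ) + 1 = n → g ⟨A, le_rfl, hA.le⟩ < (a i : EReal)) :
    ∀ᵐ ω ∂P, driftedPath W A a v ω ∈ nonIntersecting g ∨ ∃ i < n, ∃ x,
      curve (driftedPath W A a v ω) g (i + 1) x < curve (driftedPath W A a v ω) g (i + 2) x := by
  have key : ∀ i : Fin n, ∀ᵐ ω ∂P,
      (∀ x, curve (driftedPath W A a v ω) g (i + 2) x ≤ curve (driftedPath W A a v ω) g (i + 1) x)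
      → ∀ x, curve (driftedPath W A a v ω) g (i + 2) x <
        curve (driftedPath W A a v ω) g (i + 1) x := by
    rintro ⟨i, hi⟩
    by_cases hi' : i + 1 < n
    -- Two neighbouring curves: their rescaled noise difference is one Brownian motion, and starts
    -- and drifts form an affine floor for it, negative at `A` because `a` decreases.
    · have hind : IndepFun (fun ω t ↦ W ⟨i, hi⟩ t ω) (fun ω t ↦ W ⟨i + 1, hi'⟩ t ω) P :=
        hW_indep.indepFun (by simp)
      have hs : (0 : ℝ) < (√2)⁻¹ := by positivity
      filter_upwards [((hW ⟨i, hi⟩).toIsPreBrownianReal.sub_div_sqrt_two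
        (hW ⟨i + 1, hi'⟩).toIsPreBrownianReal hind).ae_lt_of_le
          (f := fun x ↦ (((√2)⁻¹ * ((a ⟨i + 1, hi'⟩ + v ⟨i + 1, hi'⟩ * (x - A)) -
            (a ⟨i, hi⟩ + v ⟨i, hi⟩ * (x - A))) : ℝ) : EReal))
          (by filter_upwards [(hW ⟨i, hi⟩).cont, (hW ⟨i + 1, hi'⟩).cont] with ω h1 h2
              fun_prop) hA
          (continuous_coe_real_ereal.comp (by fun_prop)) (fun x ↦ EReal.coe_ne_top _)
          (by
            rw [← EReal.coe_zero, EReal.coe_lt_coe_iff]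
            have : a ⟨i + 1, hi'⟩ < a ⟨i, hi⟩ := ha (by simp)
            simp only [sub_self, mul_zero, add_zero]
            exact mul_neg_of_pos_of_neg hs (by linarith)),
        ae_all_iff.2 fun i ↦ (hW i).cont] with ω hω hc
      simp only [curve_succ_of_lt _ hi, curve_succ_of_lt _ hi', driftedPath_apply hc,
        EReal.coe_lt_coe_iff, EReal.coe_le_coe_iff, mul_le_mul_iff_right₀ hs,
        mul_lt_mul_iff_right₀ hs] at hω ⊢
      exact fun h x ↦ by linarith [hω (fun x ↦ by linarith [h x]) x]
    -- The lowest curve against `g`: its affine part is subtracted from the floor, which may take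
    -- the value `⊥`.
    · have hn : n = i + 1 := by omega
      have hcurve (B : PathSpace A n) (x : Set.Icc A 0) : curve B g (i + 2) x = g x := by
        simp [curve, hi']
      have hiff (u : EReal) (b w : ℝ) : (u + (-b : ℝ) ≤ w ↔ u ≤ (b + w : ℝ)) ∧
          (u + (-b : ℝ) < w ↔ u < (b + w : ℝ)) := by
        induction u with
        | bot => simp
        | top => simp [-EReal.coe_add]
        | coe u =>
          rw [← EReal.coe_add, EReal.coe_le_coe_iff, EReal.coe_le_coe_iff, EReal.coe_lt_coe_iff,
            EReal.coe_lt_coe_iff]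
          constructor <;> constructor <;> intro h <;> linarith
      filter_upwards [(hW ⟨i, hi⟩).toIsPreBrownianReal.ae_lt_of_le (hW ⟨i, hi⟩).cont hA
          (f := fun x ↦ g x + ((-(a ⟨i, hi⟩ + v ⟨i, hi⟩ * (x - A)) : ℝ) : EReal))
          (continuous_iff_continuousAt.2 fun x ↦ by
            refine (EReal.continuousAt_add (p := (g x, ((_ : ℝ) : EReal)))
              (Or.inr (EReal.coe_ne_bot _)) (Or.inr (EReal.coe_ne_top _))).comp (f := fun x : Set.Icc A 0 ↦
                (g x, ((-(a ⟨i, hi⟩ + v ⟨i, hi⟩ * (x - A)) : ℝ) : EReal))) ?_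
            exact (hg_cont.prodMk (continuous_coe_real_ereal.comp (by fun_prop))).continuousAt)
          (fun x ↦ EReal.add_ne_top (hg_top x) (EReal.coe_ne_top _))
          (by
            rw [← EReal.coe_zero, (hiff _ _ _).2]
            simpa using hg_start ⟨i, hi⟩ hn.symm),
        ae_all_iff.2 fun i ↦ (hW i).cont] with ω hω hc
      simp only [(hiff _ _ _).1, (hiff _ _ _).2] at hω
      simpa only [hcurve, curve_succ_of_lt _ hi, driftedPath_apply hc] using hω
  filter_upwards [ae_all_iff.2 key] with ω hω
  by_cases hcross : ∃ i < n, ∃ x,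
      curve (driftedPath W A a v ω) g (i + 1) x < curve (driftedPath W A a v ω) g (i + 2) x
  · exact Or.inr hcross
  · push Not at hcross
    refine Or.inl fun x i hi ↦ ?_
    obtain ⟨h1, h2⟩ := Finset.mem_Icc.1 hi
    obtain ⟨i, rfl⟩ := Nat.exists_eq_succ_of_ne_zero (by omega : i ≠ 0)
    exact hω ⟨i, by omega⟩ (hcross i (by omega)) x

/-- A continuous floor lies below a line which starts at any given height above it. -/
lemma exists_line_above (hA : A < 0) (hg_cont : Continuous g) (hg_top : ∀ x, g x ≠ ⊤) {b : ℝ}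
    (hb : g ⟨A, le_rfl, hA.le⟩ < (b : EReal)) :
    ∃ r < b, ∃ K : ℝ, ∀ x : Set.Icc A 0, g x < ((r + K * (x - A) : ℝ) : EReal) := by
  obtain ⟨r, hr, hrb⟩ := EReal.lt_iff_exists_real_btwn.1 hb
  refine ⟨r, EReal.coe_lt_coe_iff.1 hrb, ?_⟩
  obtain ⟨xm, -, hxm⟩ := isCompact_univ.exists_isMaxOn ⟨⟨A, le_rfl, hA.le⟩, Set.mem_univ _⟩
    hg_cont.continuousOn
  obtain ⟨M, hM, -⟩ := EReal.lt_iff_exists_real_btwn.1 (hg_top xm).lt_top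
  obtain ⟨η, hη, hball⟩ := Metric.isOpen_iff.1 (isOpen_Iio.preimage hg_cont) _ hr
  -- Within `η` of `A` the floor is below `r`; beyond that the line has risen by at least `|M - r|`,
  -- above the bound `M` on the floor.
  refine ⟨|M - r| / η, fun x ↦ ?_⟩
  have hx : 0 ≤ (x : ℝ) - A := by linarith [x.2.1]
  by_cases hxη : (x : ℝ) - A < η
  · have hgx : g x < r := hball (by
      rw [Metric.mem_ball, Subtype.dist_eq, Real.dist_eq, abs_of_nonneg hx]
      exact hxη)
    refine hgx.trans_le (EReal.coe_le_coe_iff.2 ?_)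
    have : 0 ≤ |M - r| / η * (x - A) := by positivity
    linarith
  · refine ((hxm (Set.mem_univ x) : g x ≤ g xm).trans_lt hM).trans_le (EReal.coe_le_coe_iff.2 ?_)
    have h1 : |M - r| / η * η ≤ |M - r| / η * (x - A) :=
      mul_le_mul_of_nonneg_left (not_lt.1 hxη) (by positivity)
    rw [div_mul_cancel₀ _ hη.ne'] at h1
    linarith [le_abs_self (M - r)]

/-- Drifted Brownian motions started in decreasing order above a floor avoid each other and the
floor with positive probability. -/
lemma measure_driftedPath_mem_nonIntersecting_ne_zero [IsProbabilityMeasure P]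
    (hW : ∀ i, IsBrownianReal (W i) P)
    (hW_indep : iIndepFun (fun i ω t ↦ W i t ω) P) (hA : A < 0) (hn : 0 < n) (ha : StrictAnti a)
    (v : Fin n → ℝ) (hg_cont : Continuous g) (hg_top : ∀ x, g x ≠ ⊤)
    (hg_start : ∀ i : Fin n, (i : ℕ) + 1 = n → g ⟨A, le_rfl, hA.le⟩ < (a i : EReal)) :
    P {ω | driftedPath W A a v ω ∈ nonIntersecting g} ≠ 0 := by
  set last : Fin n := ⟨n - 1, by omega⟩
  obtain ⟨r, hr, K, hK⟩ := exists_line_above hA hg_cont hg_top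
    (hg_start last (by simp only [last]; omega))
  -- Tubes of half-width `ε` around the parallel lines `a i + K (x - A)` are then disjoint, and the
  -- lowest one lies above the line dominating the floor.
  obtain ⟨ε, ⟨hgap, hεr⟩, hε⟩ : ∃ ε : ℝ, ((∀ i j, i < j → 2 * ε < a i - a j) ∧
      ε < a last - r) ∧ 0 < ε := by
    have htend : Tendsto (fun ε : ℝ ↦ 2 * ε) (𝓝[>] 0) (𝓝 0) := by
      have : Tendsto (fun ε : ℝ ↦ 2 * ε) (𝓝 0) (𝓝 (2 * 0)) := tendsto_id.const_mul 2
      rw [mul_zero] at this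
      exact this.mono_left nhdsWithin_le_nhds
    refine (((eventually_all.2 fun i ↦ eventually_all.2 fun j ↦ ?_).and ?_).and
      self_mem_nhdsWithin).exists (f := 𝓝[>] (0 : ℝ))
    · by_cases hij : i < j
      · filter_upwards [htend.eventually_lt_const (sub_pos.2 (ha hij))] with ε h _ using h
      · exact Eventually.of_forall fun _ h ↦ absurd h hij
    · exact nhdsWithin_le_nhds (eventually_lt_nhds (sub_pos.2 hr))
  have : Nonempty (Set.Icc A 0) := ⟨⟨A, le_rfl, hA.le⟩⟩
  set d := TopologicalSpace.denseSeq (Set.Icc A 0)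
  -- The slope `K - v i` compensates the drift, so every drifted curve has slope `K`. Independence
  -- multiplies the tube probabilities.
  have htube (i : Fin n) := (hW i).toIsPreBrownianReal.measure_forall_abs_sub_le_ne_zero
    (hW i).cont hA (K - v i) d hε
  have hprod := hW_indep.measure_inter_preimage_eq_mul Finset.univ
    (sets := fun i ↦ {w : ℝ≥0 → ℝ | ∀ k, |w (Real.toNNReal (d k - A)) - (K - v i) * (d k - A)| ≤ ε})
    (fun i _ ↦ by
      simp only [Set.ofPred_forall]
      exact MeasurableSet.iInter fun k ↦ measurableSet_le (by fun_prop) measurable_const)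
  have hne := hprod.trans_ne (Finset.prod_ne_zero_iff.2 fun i _ ↦ htube i)
  contrapose! hne
  rw [measure_eq_zero_iff_ae_notMem] at hne ⊢
  filter_upwards [hne, ae_all_iff.2 fun i ↦ (hW i).cont] with ω hω hc hmem
  refine hω ?_
  have hclose (i : Fin n) (x : Set.Icc A 0) :
      |driftedPath W A a v ω x i - (a i + K * (x - A))| ≤ ε := by
    refine (TopologicalSpace.denseRange_denseSeq (Set.Icc A 0)).induction_on
      (p := fun x ↦ |driftedPath W A a v ω x i - (a i + K * (x - A))| ≤ ε) x
      (isClosed_le (by fun_prop) continuous_const) fun k ↦ ?_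
    have h1 := Set.mem_iInter₂.1 hmem i (Finset.mem_univ i) k
    rw [driftedPath_apply hc]
    convert h1 using 2
    ring
  intro x i hi
  obtain ⟨h1, h2⟩ := Finset.mem_Icc.1 hi
  obtain ⟨i, rfl⟩ := Nat.exists_eq_succ_of_ne_zero (by omega : i ≠ 0)
  have hi : i < n := by omega
  have hx := abs_le.1 (hclose ⟨i, hi⟩ x)
  rw [Nat.succ_eq_add_one, curve_succ_of_lt _ hi]
  by_cases hi' : i + 1 < n
  · rw [curve_succ_of_lt _ hi', EReal.coe_lt_coe_iff]
    have hx' := abs_le.1 (hclose ⟨i + 1, hi'⟩ x)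
    have := hgap ⟨i, hi⟩ ⟨i + 1, hi'⟩ (by simp)
    linarith [hx.1, hx'.2]
  · have hcurve : curve (driftedPath W A a v ω) g (i + 1 + 1) x = g x := by
      simp [curve, hi']
    have hlast : (⟨i, hi⟩ : Fin n) = last := by simp only [last, Fin.mk.injEq]; omega
    rw [hcurve]
    refine (hK x).trans (EReal.coe_lt_coe_iff.2 ?_)
    rw [hlast] at hx ⊢
    linarith [hx.1]

end Trajectories

/-! ### Normalized densities. -/

section Reweighting

variable {E : Type*} [MeasurableSpace E] {ν : Measure E} [IsProbabilityMeasure ν] {w : E → ℝ}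

lemma lintegral_ofReal_eq_ofReal_integral (hw : Measurable w) (hpos : ∀ x, 0 < w x)
    (hle : ∀ x, w x ≤ 1) :
    ∫⁻ x, ENNReal.ofReal (w x) ∂ν = ENNReal.ofReal (∫ x, w x ∂ν) ∧ 0 < ∫ x, w x ∂ν := by
  have hint : Integrable w ν := Integrable.of_bound hw.aestronglyMeasurable 1
    (ae_of_all _ fun x ↦ by rw [Real.norm_of_nonneg (hpos x).le]; exact hle x)
  refine ⟨(ofReal_integral_eq_lintegral_ofReal hint (ae_of_all _ fun x ↦ (hpos x).le)).symm, ?_⟩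
  rw [integral_pos_iff_support_of_nonneg (fun x ↦ (hpos x).le) hint]
  have : Function.support w = Set.univ := Set.eq_univ_of_forall fun x ↦ (hpos x).ne'
  simp [this]

lemma isProbabilityMeasure_inv_smul_withDensity (hw : Measurable w) (hpos : ∀ x, 0 < w x)
    (hle : ∀ x, w x ≤ 1) :
    IsProbabilityMeasure ((∫⁻ x, ENNReal.ofReal (w x) ∂ν)⁻¹ •
      ν.withDensity fun x ↦ ENNReal.ofReal (w x)) where
  measure_univ := by
    obtain ⟨h1, h2⟩ := lintegral_ofReal_eq_ofReal_integral (ν := ν) hw hpos hle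
    rw [Measure.smul_apply, withDensity_apply _ .univ, setLIntegral_univ, smul_eq_mul, h1]
    exact ENNReal.inv_mul_cancel (by simpa using h2) ENNReal.ofReal_ne_top

lemma integral_inv_smul_withDensity (hw : Measurable w) (hpos : ∀ x, 0 < w x)
    (hle : ∀ x, w x ≤ 1) (F : E → ℝ) :
    ∫ x, F x ∂((∫⁻ x, ENNReal.ofReal (w x) ∂ν)⁻¹ • ν.withDensity fun x ↦ ENNReal.ofReal (w x)) =
      (∫ x, w x ∂ν)⁻¹ * ∫ x, w x * F x ∂ν := by
  obtain ⟨h1, h2⟩ := lintegral_ofReal_eq_ofReal_integral (ν := ν) hw hpos hle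
  rw [integral_smul_measure, h1, ENNReal.toReal_inv, ENNReal.toReal_ofReal h2.le,
    integral_withDensity_eq_integral_toReal_smul hw.ennreal_ofReal
      (ae_of_all _ fun x ↦ ENNReal.ofReal_lt_top), smul_eq_mul]
  simp [ENNReal.toReal_ofReal (hpos _).le]

end Reweighting

/-! ### Convergence of weighted expectations. -/

section Convergence

variable {Ω : Type*} [MeasurableSpace Ω] {P : Measure Ω} {n : ℕ}
  {W : Fin n → ℝ≥0 → Ω → ℝ} {A : ℝ} {a : Fin n → ℝ} {g : Set.Icc A 0 → EReal}

lemma integral_cond_driftedBrownianLaw (hW : ∀ i, IsBrownianReal (W i) P)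
    (a v : Fin n → ℝ) {s : Set (PathSpace A n)} (hs : MeasurableSet s) {F : PathSpace A n → ℝ}
    (hF : Continuous F) :
    ∫ B, F B ∂(ProbabilityTheory.cond (driftedBrownianLaw P W A a v) s) =
      (∫ ω, s.indicator 1 (driftedPath W A a v ω) ∂P)⁻¹ *
      ∫ ω, s.indicator 1 (driftedPath W A a v ω) * F (driftedPath W A a v ω) ∂P := by
  have hX := aemeasurable_driftedPath hW A a v
  have hind : Measurable (s.indicator (1 : PathSpace A n → ℝ)) := measurable_one.indicator hs
  rw [ProbabilityTheory.cond, integral_smul_measure, ENNReal.toReal_inv, ← integral_indicator hs,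
    smul_eq_mul, ← measureReal_def, ← integral_indicator_one hs, driftedBrownianLaw,
    ← integral_map hX hind.aestronglyMeasurable,
    ← integral_map (f := fun B ↦ s.indicator 1 B * F B) hX
      (hind.mul hF.measurable).aestronglyMeasurable]
  congr 2
  ext B
  by_cases hB : B ∈ s <;> simp [hB]

variable [IsProbabilityMeasure P]

lemma isProbabilityMeasure_driftedBrownianLaw (hW : ∀ i, IsBrownianReal (W i) P) (A : ℝ)
    (a v : Fin n → ℝ) : IsProbabilityMeasure (driftedBrownianLaw P W A a v) :=
  Measure.isProbabilityMeasure_map (aemeasurable_driftedPath hW A a v)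

lemma isProbabilityMeasure_oneSidedGibbs (hW : ∀ i, IsBrownianReal (W i) P) (hn : 0 < n)
    (hg_cont : Continuous g) (hg_top : ∀ x, g x ≠ ⊤) (α : ℝ) {L : ℝ} (hL : 0 < L)
    (a : Fin n → ℝ) : IsProbabilityMeasure (oneSidedGibbs P W α L A a g) := by
  have := isProbabilityMeasure_driftedBrownianLaw hW A a (alternatingDrift n (α * √L))
  exact isProbabilityMeasure_inv_smul_withDensity
    (continuous_gibbsWeight hg_cont hg_top hn hL).measurable (gibbsWeight_pos L)
    (gibbsWeight_le_one hL.le)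

/-- Pulling everything back to `Ω` turns measures that vary with the scale into quotients of
integrals over one fixed probability space, where dominated convergence applies. -/
lemma integral_oneSidedGibbs (hW : ∀ i, IsBrownianReal (W i) P) (hn : 0 < n)
    (hg_cont : Continuous g) (hg_top : ∀ x, g x ≠ ⊤) (α : ℝ) {L : ℝ} (hL : 0 < L)
    (a : Fin n → ℝ) {F : PathSpace A n → ℝ} (hF : Continuous F) :
    ∫ B, F B ∂oneSidedGibbs P W α L A a g =
      (∫ ω, gibbsWeight L g (driftedPath W A a (alternatingDrift n (α * √L)) ω) ∂P)⁻¹ *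
      ∫ ω, gibbsWeight L g (driftedPath W A a (alternatingDrift n (α * √L)) ω) *
        F (driftedPath W A a (alternatingDrift n (α * √L)) ω) ∂P := by
  have := isProbabilityMeasure_driftedBrownianLaw hW A a (alternatingDrift n (α * √L))
  have hw := continuous_gibbsWeight hg_cont hg_top hn hL
  rw [oneSidedGibbs, integral_inv_smul_withDensity hw.measurable (gibbsWeight_pos L)
    (gibbsWeight_le_one hL.le), driftedBrownianLaw,
    integral_map (aemeasurable_driftedPath hW _ _ _) hw.measurable.aestronglyMeasurable,
    integral_map (f := fun B ↦ gibbsWeight L g B * F B) (aemeasurable_driftedPath hW _ _ _)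
      (hw.mul hF).measurable.aestronglyMeasurable]

/-- Expectations weighted by the Gibbs weight converge to expectations over the non-intersection
event. -/
lemma tendsto_integral_gibbsWeight_mul {ι : Type*} {l : Filter ι} [l.IsCountablyGenerated]
    (hW : ∀ i, IsBrownianReal (W i) P)
    (hW_indep : iIndepFun (fun i ω t ↦ W i t ω) P) (hA : A < 0) (hn : 0 < n) (ha : StrictAnti a)
    (v : Fin n → ℝ) (hg_cont : Continuous g) (hg_top : ∀ x, g x ≠ ⊤)
    (hg_start : ∀ i : Fin n, (i : ℕ) + 1 = n → g ⟨A, le_rfl, hA.le⟩ < (a i : EReal))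
    {Λ : ι → ℝ} (hΛ : Tendsto Λ l atTop) (hΛ_pos : ∀ i, 0 < Λ i)
    {aL : ι → Fin n → ℝ} (haL : Tendsto aL l (𝓝 a))
    {gL : ι → Set.Icc A 0 → EReal} (hgL_cont : ∀ L, Continuous (gL L))
    (hgL_top : ∀ L x, gL L x ≠ ⊤) (hgL : FloorsTendstoUniformly gL g l)
    {F : PathSpace A n → ℝ} (hF : Continuous F) {C : ℝ} (hC : ∀ B, |F B| ≤ C) :
    Tendsto (fun L ↦ ∫ ω, gibbsWeight (Λ L) (gL L) (driftedPath W A (aL L) v ω) *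
        F (driftedPath W A (aL L) v ω) ∂P) l
      (𝓝 (∫ ω, (nonIntersecting g).indicator 1 (driftedPath W A a v ω) *
        F (driftedPath W A a v ω) ∂P)) := by
  refine tendsto_integral_filter_of_dominated_convergence (fun _ ↦ C)
    (Eventually.of_forall fun L ↦ ?_) (Eventually.of_forall fun L ↦ ae_of_all _ fun ω ↦ ?_)
    (integrable_const C) ?_
  · exact (((continuous_gibbsWeight (hgL_cont L) (hgL_top L) hn (hΛ_pos L)).mul
      hF).measurable.comp_aemeasurable (aemeasurable_driftedPath hW _ _ _)).aestronglyMeasurable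
  · rw [norm_mul, Real.norm_of_nonneg (gibbsWeight_pos _ _).le, Real.norm_eq_abs]
    calc _ ≤ 1 * C := mul_le_mul (gibbsWeight_le_one (hΛ_pos L).le _) (hC _) (abs_nonneg _)
          zero_le_one
      _ = C := one_mul C
  -- Touching without crossing, where the limit of the weight is not controlled, is excluded almost
  -- surely.
  · filter_upwards [ae_driftedPath_mem_nonIntersecting_or hW hW_indep hA ha v hg_cont hg_top
      hg_start, ae_all_iff.2 fun i ↦ (hW i).cont] with ω hω hc
    have hB : Tendsto (fun L ↦ driftedPath W A (aL L) v ω) l (𝓝 (driftedPath W A a v ω)) := by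
      rw [funext fun L ↦ driftedPath_eq_const_add hc A (aL L) v, driftedPath_eq_const_add hc A a v]
      exact ((ContinuousMap.continuous_const'.tendsto a).comp haL).add_const _
    refine Tendsto.mul ?_ ((hF.tendsto _).comp hB)
    by_cases hmem : driftedPath W A a v ω ∈ nonIntersecting g
    · rw [Set.indicator_of_mem hmem]
      exact tendsto_gibbsWeight_of_mem hA hn hΛ hΛ_pos hg_cont hg_top hgL_cont hgL_top hgL hB hmem
    · rw [Set.indicator_of_notMem hmem]
      obtain ⟨i, hi, x, hx⟩ := hω.resolve_left hmem
      exact tendsto_gibbsWeight_of_curve_lt hA hn hΛ hΛ_pos hg_cont hg_top hgL_cont hgL_top hgL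
        hB hi hx

end Convergence

/-! ### Weak convergence of the Gibbs measures. -/

theorem theorem7p14 {Ω : Type*} [MeasurableSpace Ω] (P : Measure Ω) [IsProbabilityMeasure P]
    (m : ℕ) (hm : 1 ≤ m)
    -- independent standard Brownian motions, used only to speak of their law
    (W : Fin (2 * m) → ℝ≥0 → Ω → ℝ) (hW : ∀ i, IsBrownianReal (W i) P)
    (hW_indep : iIndepFun (fun i ω t ↦ W i t ω) P)
    (μ A : ℝ) (hA : A < 0)
    (a : Fin (2 * m) → ℝ) (ha : StrictAnti a)
    (g : Set.Icc A 0 → EReal) (hg_cont : Continuous g) (hg_top : ∀ x, g x ≠ ⊤)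
    (hg_start : g ⟨A, le_rfl, hA.le⟩ < ((a ⟨2 * m - 1, by omega⟩ : ℝ) : EReal))
    -- the data at scale `L ≥ 1`
    (aL : Set.Ici (1 : ℝ) → Fin (2 * m) → ℝ) (haL : Tendsto aL atTop (𝓝 a))
    (gL : Set.Ici (1 : ℝ) → Set.Icc A 0 → EReal) (hgL_cont : ∀ L, Continuous (gL L))
    (hgL_top : ∀ L x, gL L x ≠ ⊤) (hgL : FloorsTendstoUniformly gL g atTop) :
    ∃ (hGibbs : ∀ L : Set.Ici (1 : ℝ),
        IsProbabilityMeasure (oneSidedGibbs P W (μ / √(L : ℝ)) L A (aL L) (gL L)))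
      (hLim : IsProbabilityMeasure (nonIntersectingLaw P W μ A a g)),
      Tendsto (β := ProbabilityMeasure (PathSpace A (2 * m)))
        (fun L : Set.Ici (1 : ℝ) ↦
          ⟨oneSidedGibbs P W (μ / √(L : ℝ)) L A (aL L) (gL L), hGibbs L⟩)
        atTop (𝓝 ⟨nonIntersectingLaw P W μ A a g, hLim⟩) := by
  have hn : 0 < 2 * m := by omega
  have hpos (L : Set.Ici (1 : ℝ)) : 0 < (L : ℝ) := zero_lt_one.trans_le L.2
  have hdrift (L : Set.Ici (1 : ℝ)) : μ / √(L : ℝ) * √(L : ℝ) = μ :=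
    div_mul_cancel₀ _ (Real.sqrt_pos.2 (hpos L)).ne'
  have hstart (i : Fin (2 * m)) (hi : (i : ℕ) + 1 = 2 * m) :
      g ⟨A, le_rfl, hA.le⟩ < (a i : EReal) := by
    have : i = ⟨2 * m - 1, by omega⟩ := Fin.ext (by simp only; omega)
    rwa [this]
  have hΛ : Tendsto (fun L : Set.Ici (1 : ℝ) ↦ (L : ℝ)) atTop atTop :=
    tendsto_comp_val_Ici_atTop.2 tendsto_id
  -- Needed for dominated convergence along the continuous parameter `L`.
  have : (atTop : Filter (Set.Ici (1 : ℝ))).IsCountablyGenerated := by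
    rw [atTop_Ici_eq]
    infer_instance
  set v := alternatingDrift (2 * m) μ with hv
  have hX := aemeasurable_driftedPath hW A a v
  have hN : MeasurableSet (nonIntersecting (A := A) (n := 2 * m) g) :=
    (isOpen_nonIntersecting hg_cont hg_top).measurableSet
  have hPN := measure_driftedPath_mem_nonIntersecting_ne_zero hW hW_indep hA hn ha v hg_cont
    hg_top hstart
  have hlaw := isProbabilityMeasure_driftedBrownianLaw hW A a v
  have hνN : driftedBrownianLaw P W A a v (nonIntersecting g) ≠ 0 := by
    rwa [driftedBrownianLaw, Measure.map_apply_of_aemeasurable hX hN]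
  have hZ : ∫ ω, (nonIntersecting g).indicator (1 : PathSpace A (2 * m) → ℝ) (driftedPath W A a v ω) ∂P ≠ 0 := by
    rw [← integral_map (f := (nonIntersecting g).indicator (1 : PathSpace A (2 * m) → ℝ)) hX
      (measurable_one.indicator hN).aestronglyMeasurable, integral_indicator_one hN]
    exact (ENNReal.toReal_pos hνN (measure_ne_top _ _)).ne'
  refine ⟨fun L ↦ isProbabilityMeasure_oneSidedGibbs hW hn (hgL_cont L) (hgL_top L) _ (hpos L) _,
    cond_isProbabilityMeasure hνN, ?_⟩
  refine ProbabilityMeasure.tendsto_iff_forall_integral_tendsto.2 fun F ↦ ?_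
  simp only [ProbabilityMeasure.coe_mk]
  change Tendsto _ _ (𝓝 (∫ B, F B ∂ProbabilityTheory.cond (driftedBrownianLaw P W A a v)
    (nonIntersecting g)))
  rw [integral_cond_driftedBrownianLaw hW a v hN F.continuous]
  simp_rw [fun L : Set.Ici (1 : ℝ) ↦ integral_oneSidedGibbs hW hn (hgL_cont L) (hgL_top L)
    (μ / √(L : ℝ)) (hpos L) (aL L) F.continuous, hdrift, ← hv]
  -- The normalizer is the case `F = 1` of the numerator; its limit is nonzero by positivity of the
  -- non-intersection probability.
  refine Tendsto.mul (Tendsto.inv₀ ?_ hZ) ?_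
  · simpa using tendsto_integral_gibbsWeight_mul hW hW_indep hA hn ha v hg_cont hg_top hstart hΛ
      hpos haL hgL_cont hgL_top hgL (F := fun _ ↦ 1) continuous_const (C := 1) (by simp)
  · exact tendsto_integral_gibbsWeight_mul hW hW_indep hA hn ha v hg_cont hg_top hstart hΛ
      hpos haL hgL_cont hgL_top hgL F.continuous (C := ‖F‖) F.norm_coe_le_norm
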